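/- Let $(\Omega,\mathcal F,\mathbb P)$ be a probability space, let $\xi_1,\xi_2,\dots$ be i.i.d. random elements of a measurable space $\Xi$ with law $P$, let $X$ be a nonempty set, and let $h:X\times\Xi\to\mathbb R$ be such that every section $h_x=h(x,\cdot)$ is measurable and $P$-integrable. Put $$f(x)=\int h_x\,dP,\quad \hat f_n(x)=\frac1n\sum_{i=1}^n h(x,\xi_i),\quad \psi^*=\inf_X f,\quad \hat\psi_n=\inf_X\hat f_n,$$ $$S^\varepsilon=\{x\in X: f(x)\le\psi^*+\varepsilon\},\qquad \hat S_n^\delta=\{x\in X:\hat f_n(x)\le\hat\psi_n+\delta\}.$$ Let $\ell^\infty(X)$ be the space of bounded real functions on $X$ with the supremum norm. For possibly nonmeasurable $U:\Omega\to[-\infty,\infty]$ let $\mathbb E^*U$ be the infimum of $\mathbb E[V]$ over measurable $V\ge U$ for which $\mathbb E[V]$ exists, and let $\mathbb P^*(A)=\mathbb E^*\mathbf 1_A$. Write $U_n=O_{\mathbb P^*}(r_n)$ if for every $\varepsilon>0$ there is $M<\infty$ with $\limsup_n\mathbb P^*(|U_n|>Mr_n)\le\varepsilon$. Weak convergence $Z_n\rightsquigarrow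 Z$ of possibly nonmeasurable maps is in the Hoffmann-Jørgensen sense: $Z$ is Borel measurable and $\mathbb E^*\varphi(Z_n)\to\mathbb E\varphi(Z)$ for every bounded continuous real function $\varphi$. **Corollary (Donsker theorem implications).** Assume that $f\in\ell^\infty(X)$, that for all sufficiently large $n$ almost surely $\hat f_n\in\ell^\infty(X)$, and that, for a Borel measurable random element $G$ of $\ell^\infty(X)$, $$\sqrt n(\hat f_n-f)\rightsquigarrow G\quad\text{in }\ell^\infty(X).$$ Then: 1. $\displaystyle\sqrt n(\hat\psi_n-\psi^*)\rightsquigarrow\lim_{\varepsilon\downarrow0}\inf_{x\in S^\varepsilon}G(x)$, where the limit on the right exists on every sample path. 2. $\hat\psi_n-\psi^*=O_{\mathbb P^*}(n^{-1/2})$. 3. Let $(\delta_n)$ be a nonnegative deterministic sequence with $\delta_n=O(n^{-1/2})$, and let $\hat x_n:\Omega\to X$ be maps for which there are events $A_1\subseteq A_2\subseteq\cdots$ with $\mathbb P(\bigcup_N A_N)=1$ such that $\hat x_n(\omega)\in\hat S_n^{\delta_n}(\omega)$ for all $N$, all $\omega\in A_N$ and all $n\ge N$. Then $f(\hat x_n)-\psi^*=O_{\mathbb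 P^*}(n^{-1/2})$. 4. If, in addition to the assumptions of 3, $X\subseteq\mathbb R^d$, $S^0\ne\varnothing$, and for some $\kappa\ge1$ and $\alpha>0$ $$f(x)-\psi^*\ge\alpha\,\operatorname{dist}(x,S^0)^\kappa\qquad\text{for all }x\in X$$ (Euclidean distance), then $\operatorname{dist}(\hat x_n,S^0)=O_{\mathbb P^*}(n^{-1/(2\kappa)})$. -/

import Mathlib

open MeasureTheory ProbabilityTheory Filter Topology
open scoped ENNReal BoundedContinuousFunction

/-! ### Outer expectation, outer probability, Hoffmann-Jørgensen weak convergence -/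

/-- The positive part of the integral of an extended real function, `∫ V⁺ dμ`. -/
noncomputable def posIntegral {Ω : Type*} [MeasurableSpace Ω] (μ : Measure Ω)
    (V : Ω → EReal) : ℝ≥0∞ :=
  ∫⁻ ω, (V ω).toENNReal ∂μ

/-- `E[V]` exists: at least one of `∫ V⁺` and `∫ V⁻` is finite. -/
def ExpectationExists {Ω : Type*} [MeasurableSpace Ω] (μ : Measure Ω) (V : Ω → EReal) : Prop :=
  posIntegral μ V ≠ ⊤ ∨ posIntegral μ (fun ω => -V ω) ≠ ⊤

/-- `E[V] = ∫ V⁺ - ∫ V⁻`, as an extended real number. -/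
noncomputable def extExpectation {Ω : Type*} [MeasurableSpace Ω] (μ : Measure Ω)
    (V : Ω → EReal) : EReal :=
  (posIntegral μ V : EReal) - (posIntegral μ (fun ω => -V ω) : EReal)

/-- The outer expectation `E* U` of a possibly nonmeasurable map `U` into the extended reals:
the infimum of `E[V]` over the measurable `V ≥ U` for which `E[V]` exists. -/
noncomputable def outerExpectation {Ω : Type*} [MeasurableSpace Ω] (μ : Measure Ω)
    (U : Ω → EReal) : EReal :=
  sInf {a : EReal | ∃ V : Ω → EReal, Measurable V ∧ (∀ ω, U ω ≤ V ω) ∧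
    ExpectationExists μ V ∧ a = extExpectation μ V}

/-- The outer probability `P*(A) = E* 1_A` of an arbitrary set `A`. -/
noncomputable def outerProb {Ω : Type*} [MeasurableSpace Ω] (μ : Measure Ω)
    (A : Set Ω) : EReal :=
  outerExpectation μ (A.indicator fun _ => 1)

/-- Outer probability is the value of the measure, which Mathlib extends to all sets by the
infimum over measurable supersets. -/
theorem outerProb_eq {Ω : Type*} [MeasurableSpace Ω] (μ : Measure Ω) (A : Set Ω) :
    outerProb μ A = (μ A : EReal) := by
  have one : (1 : EReal).toENNReal = 1 := by
    simpa using EReal.toENNReal_coe (x := 1)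
  have key : ∀ V : Ω → EReal, (∀ ω, 0 ≤ V ω) → posIntegral μ (fun ω => -V ω) = 0 := by
    intro V hV
    have h0 : ∀ ω, (-V ω).toENNReal = 0 := fun ω =>
      EReal.toENNReal_of_nonpos (by simpa using hV ω)
    simp [posIntegral, h0]
  apply le_antisymm
  · refine sInf_le ⟨(toMeasurable μ A).indicator fun _ => 1,
      measurable_const.indicator (measurableSet_toMeasurable μ A), ?_, ?_, ?_⟩
    · intro ω
      exact Set.indicator_le_indicator_of_subset (subset_toMeasurable μ A)
        (fun _ => zero_le_one) ω
    · right
      rw [key _ (fun ω => Set.indicator_nonneg (fun _ _ => zero_le_one) ω)]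
      exact ENNReal.zero_ne_top
    · rw [extExpectation, key _ (fun ω => Set.indicator_nonneg (fun _ _ => zero_le_one) ω)]
      have h1 : posIntegral μ ((toMeasurable μ A).indicator fun _ => 1) = μ A := by
        have h2 : ∀ ω, ((toMeasurable μ A).indicator (fun _ => (1 : EReal)) ω).toENNReal
            = (toMeasurable μ A).indicator (fun _ => (1 : ℝ≥0∞)) ω := by
          intro ω
          by_cases h : ω ∈ toMeasurable μ A <;> simp [h, one]
        simp only [posIntegral, h2]
        rw [lintegral_indicator (measurableSet_toMeasurable μ A)]
        simp [measure_toMeasurable]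
      rw [h1]
      simp
  · refine le_sInf ?_
    rintro a ⟨V, hVm, hV, -, rfl⟩
    have hV0 : ∀ ω, 0 ≤ V ω := fun ω =>
      (Set.indicator_nonneg (fun _ _ => zero_le_one) ω).trans (hV ω)
    rw [extExpectation, key V hV0]
    have h1 : μ A ≤ posIntegral μ V := by
      have hm : Measurable fun ω => (V ω).toENNReal := measurable_ereal_toENNReal.comp hVm
      calc μ A ≤ μ {ω | 1 ≤ (V ω).toENNReal} := by
            refine measure_mono fun ω hω => ?_
            have h2 := hV ω
            rw [Set.indicator_of_mem hω] at h2
            have h3 := EReal.toENNReal_le_toENNReal h2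
            simpa [one] using h3
        _ ≤ posIntegral μ V := by
            simpa [posIntegral] using mul_meas_ge_le_lintegral hm 1
    simpa using h1

/-- `U_n = O_{P*}(r_n)`: for every `ε > 0` there is a finite `M` with
`limsup_n P*(|U_n| > M r_n) ≤ ε`. -/
def IsBigOPStar {Ω : Type*} [MeasurableSpace Ω] (μ : Measure Ω)
    (U : ℕ → Ω → ℝ) (r : ℕ → ℝ) : Prop :=
  ∀ ε : ℝ, 0 < ε → ∃ M : ℝ,
    limsup (fun n => outerProb μ {ω | M * r n < |U n ω|}) atTop ≤ (ε : EReal)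

/-- Weak convergence `Z_n ⇝ G` in the Hoffmann-Jørgensen sense: the limit `G` is Borel measurable
and `E* φ(Z_n) → E φ(G)` for every bounded continuous real function `φ`. The maps `Z_n` need not
be measurable, and `G` may live on another probability space. -/
def HJWeakConv {Ω Ω' E : Type*} [MeasurableSpace Ω] [MeasurableSpace Ω'] [TopologicalSpace E]
    (μ : Measure Ω) (Z : ℕ → Ω → E) (ν : Measure Ω') (G : Ω' → E) : Prop :=
  Measurable[_, borel E] G ∧
    ∀ φ : E →ᵇ ℝ,
      Tendsto (fun n => outerExpectation μ (fun ω => ((φ (Z n ω) : ℝ) : EReal))) atTop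
        (𝓝 ((∫ ω', φ (G ω') ∂ν : ℝ) : EReal))

/-! ### Bounded functions, infima and near-minimizers -/

/-- The Banach space `ℓ^∞(X)` of bounded real functions on `X` with the supremum norm. -/
abbrev EllInfty (X : Type*) : Type _ := lp (fun _ : X => ℝ) ⊤

/-- A real function on `X` regarded as an element of `ℓ^∞(X)`. For unbounded functions, where this
makes no sense, the value is `0`. -/
noncomputable def toEllInfty {X : Type*} (g : X → ℝ) : EllInfty X :=
  open Classical in if hg : Memℓp g ⊤ then ⟨g, hg⟩ else 0

/-- The infimum functional `ι(g) = inf_{x ∈ X} g(x)`. -/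
noncomputable def infVal {X : Type*} (g : X → ℝ) : ℝ := ⨅ x, g x

/-- The `ε`-minimizers of `g`. -/
def nearMin {X : Type*} (g : X → ℝ) (ε : ℝ) : Set X := {x | g x ≤ infVal g + ε}

/-- Sharp growth of order `κ ≥ 1`. Here `e` is the inclusion of `X` into `ℝ^d`; there is an exact
minimizer, and `f(x) - ι(f) ≥ α dist(x, S^0)^κ` for some `α > 0` and all `x`. -/
def SharpGrowth {X : Type*} {d : ℕ} (e : X → EuclideanSpace ℝ (Fin d)) (f : X → ℝ)
    (κ : ℝ) : Prop :=
  1 ≤ κ ∧ (nearMin f 0).Nonempty ∧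
    ∃ α : ℝ, 0 < α ∧ ∀ x, α * Metric.infDist (e x) (e '' nearMin f 0) ^ κ ≤ f x - infVal f

/-! ### Expected and empirical objectives -/

/-- The expected objective `f(x) = P h_x`. -/
noncomputable def expObj {X Ξ : Type*} [MeasurableSpace Ξ] (h : X → Ξ → ℝ) (P : Measure Ξ) :
    X → ℝ :=
  fun x => ∫ z, h x z ∂P

/-- The empirical objective `(1/n) ∑ h(x, ξ_i)` over the first `n` sample points; the sample
`ξ_1, ξ_2, …` is indexed from `0`. -/
noncomputable def empObj {X Ξ Ω : Type*} (h : X → Ξ → ℝ) (ξ : ℕ → Ω → Ξ) (n : ℕ) (ω : Ω) :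
    X → ℝ :=
  fun x => (1 / (n : ℝ)) * ∑ i ∈ Finset.range n, h x (ξ i ω)

/-- Empirical minimizer membership: there are increasing events `A_N` whose union has probability
one, such that `x̂_n(ω)` is a `δ_n`-minimizer of the `n`-th empirical objective whenever
`ω ∈ A_N` and `n ≥ N`. -/
def EmpMinMembership {X Ξ Ω : Type*} [MeasurableSpace Ω] (μ : Measure Ω) (h : X → Ξ → ℝ)
    (ξ : ℕ → Ω → Ξ) (δ : ℕ → ℝ) (xhat : ℕ → Ω → X) : Prop :=
  ∃ A : ℕ → Set Ω, (∀ N, MeasurableSet (A N)) ∧ (∀ N, A N ⊆ A (N + 1)) ∧ μ (⋃ N, A N) = 1 ∧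
    ∀ N, ∀ ω ∈ A N, ∀ n, N ≤ n → xhat n ω ∈ nearMin (empObj h ξ n ω) (δ n)

/-! For `c ≥ 0` and bounded `z` put `Φ_c(z) = inf_x (c (f(x) - ψ*) + z(x))`, which is
`penalizedInf`. With `Z_n = √n (f̂_n - f)`, the quantity `√n (ψ̂_n - ψ*)` is exactly `Φ_c(Z_n)` at
`c = √n`. Each `Φ_c` is 1-Lipschitz, bounded by `‖z‖`, and increasing in `c`, since the penalty is
nonnegative. As `c → ∞` the penalty confines the infimum to ever smaller near-minimal sets, so
`Φ_c(z)` increases to `Λ(z) = lim_{ε↓0} inf_{S^ε} z` (`tendsto_iInf_nearMin`), which is again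
1-Lipschitz.

Hence `Φ_{√m}(Z_n) ≤ √n (ψ̂_n - ψ*) ≤ Λ(Z_n)` almost surely for large `n ≥ m`. Applying a monotone
or antitone test function keeps this sandwich; the outer bounds converge by the hypothesis on `Z_n`,
and their limits merge as `m → ∞` by dominated convergence (`HJWeakConv.of_monotone_approx`). Such
test functions suffice on the real line (`hjWeakConv_of_monotone_antitone`): up to small errors, a
bounded continuous function is a monotone one plus an antitone one.

The rates follow because `‖Z_n‖` is bounded in outer probability, while `√n |ψ̂_n - ψ*| ≤ ‖Z_n‖` and
`√n (f(x̂_n) - ψ*) ≤ 2 ‖Z_n‖ + √n δ_n`. The growth condition turns the latter into a rate for the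
distance. -/

/-! ### The outer expectation of bounded functions -/

section UpperMean

variable {Ω : Type*} [MeasurableSpace Ω] (μ : Measure Ω)

/-- The outer expectation of a real function, as a real number. -/
noncomputable def upperMean (U : Ω → ℝ) : ℝ :=
  (outerExpectation μ fun ω => (U ω : EReal)).toReal

theorem posIntegral_coe (V : Ω → ℝ) :
    posIntegral μ (fun ω => (V ω : EReal)) = ∫⁻ ω, ENNReal.ofReal (V ω) ∂μ := by
  simp only [posIntegral, EReal.real_coe_toENNReal]

variable {μ}

theorem expectationExists_coe {V : Ω → ℝ} (hV : Integrable V μ) :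
    ExpectationExists μ fun ω => (V ω : EReal) := by
  left
  rw [posIntegral_coe]
  exact hV.lintegral_lt_top.ne

theorem extExpectation_coe {V : Ω → ℝ} (hV : Integrable V μ) :
    extExpectation μ (fun ω => (V ω : EReal)) = ((∫ ω, V ω ∂μ : ℝ) : EReal) := by
  have h2 : posIntegral μ (fun ω => -(V ω : EReal)) = ∫⁻ ω, ENNReal.ofReal (-V ω) ∂μ := by
    rw [← posIntegral_coe]
    simp only [EReal.coe_neg]
  rw [extExpectation, posIntegral_coe, h2, integral_eq_lintegral_pos_part_sub_lintegral_neg_part hV,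
    EReal.coe_sub]
  rw [EReal.coe_ennreal_toReal hV.lintegral_lt_top.ne,
    EReal.coe_ennreal_toReal (x := ∫⁻ ω, ENNReal.ofReal (-V ω) ∂μ) hV.neg.lintegral_lt_top.ne]

theorem extExpectation_mono {V W : Ω → EReal} (h : ∀ ω, V ω ≤ W ω) :
    extExpectation μ V ≤ extExpectation μ W := by
  refine EReal.sub_le_sub ?_ ?_
  · exact EReal.coe_ennreal_le_coe_ennreal_iff.2
      (lintegral_mono fun ω => EReal.toENNReal_le_toENNReal (h ω))
  · exact EReal.coe_ennreal_le_coe_ennreal_iff.2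
      (lintegral_mono fun ω => EReal.toENNReal_le_toENNReal (EReal.neg_le_neg_iff.2 (h ω)))

variable [IsProbabilityMeasure μ]

theorem integrable_of_abs_le {V : Ω → ℝ} (hV : Measurable V) {C : ℝ} (h : ∀ ω, |V ω| ≤ C) :
    Integrable V μ :=
  Integrable.of_bound hV.aestronglyMeasurable C (Eventually.of_forall h)

theorem lintegral_ofReal_const_sub_ne_top {U : Ω → ℝ} {C : ℝ} (hU : ∀ ω, |U ω| ≤ C) :
    ∫⁻ ω, ENNReal.ofReal (C - U ω) ∂μ ≠ ⊤ := by
  refine ne_top_of_le_ne_top (b := ENNReal.ofReal (2 * C)) ENNReal.ofReal_ne_top ?_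
  calc ∫⁻ ω, ENNReal.ofReal (C - U ω) ∂μ ≤ ∫⁻ _, ENNReal.ofReal (2 * C) ∂μ :=
        lintegral_mono fun ω => ENNReal.ofReal_le_ofReal (by linarith [abs_le.1 (hU ω)])
    _ = ENNReal.ofReal (2 * C) := by simp

theorem integral_eq_sub_lintegral {V : Ω → ℝ} (hVm : Measurable V) {C : ℝ}
    (hV : ∀ ω, |V ω| ≤ C) :
    ∫ ω, V ω ∂μ = C - (∫⁻ ω, ENNReal.ofReal (C - V ω) ∂μ).toReal := by
  rw [← integral_eq_lintegral_of_nonneg_ae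
    (Eventually.of_forall fun ω => sub_nonneg.2 (abs_le.1 (hV ω)).2)
    (measurable_const.sub hVm).aestronglyMeasurable,
    integral_sub (integrable_const C) (integrable_of_abs_le hVm hV)]
  simp

/-- Since the Lebesgue integral of a nonmeasurable function is its lower integral, the outer
expectation of `U ≤ C` is `C - ∫⁻ (C - U)`. -/
theorem outerExpectation_coe {U : Ω → ℝ} {C : ℝ} (hU : ∀ ω, |U ω| ≤ C) :
    outerExpectation μ (fun ω => (U ω : EReal)) =
      ((C - (∫⁻ ω, ENNReal.ofReal (C - U ω) ∂μ).toReal : ℝ) : EReal) := by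
  apply le_antisymm
  -- A measurable minorant `g` of `C - U` with the same integral makes `C - g` a measurable majorant
  -- of `U` that attains the infimum.
  · obtain ⟨g, hgm, hg, hgi⟩ :=
      exists_measurable_le_lintegral_eq μ fun ω => ENNReal.ofReal (C - U ω)
    have hgr : ∀ ω, (g ω).toReal ≤ C - U ω := fun ω =>
      ENNReal.toReal_le_of_le_ofReal (sub_nonneg.2 (abs_le.1 (hU ω)).2) (hg ω)
    have hgt : ∀ ω, g ω ≠ ⊤ := fun ω => ne_top_of_le_ne_top ENNReal.ofReal_ne_top (hg ω)
    have hVm : Measurable fun ω => C - (g ω).toReal := measurable_const.sub hgm.ennreal_toReal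
    have hV : ∀ ω, |C - (g ω).toReal| ≤ C := fun ω => by
      have h1 := hgr ω
      have h2 := abs_le.1 (hU ω)
      have h3 : 0 ≤ (g ω).toReal := ENNReal.toReal_nonneg
      rw [abs_le]
      constructor <;> linarith
    refine sInf_le ⟨fun ω => ((C - (g ω).toReal : ℝ) : EReal), hVm.coe_real_ereal, fun ω => ?_,
      expectationExists_coe (integrable_of_abs_le hVm hV), ?_⟩
    · exact EReal.coe_le_coe_iff.2 (by linarith [hgr ω])
    · rw [extExpectation_coe (integrable_of_abs_le hVm hV), integral_eq_sub_lintegral hVm hV, hgi]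
      simp only [sub_sub_cancel, ENNReal.ofReal_toReal (hgt _)]
  · refine le_sInf ?_
    rintro a ⟨V, hVm, hV, -, rfl⟩
    -- Capping a majorant at `C` keeps it a majorant, does not raise its expectation, and makes it
    -- real and bounded.
    have hlow : ∀ ω, (U ω : EReal) ≤ min (V ω) C := fun ω =>
      le_min (hV ω) (EReal.coe_le_coe_iff.2 (abs_le.1 (hU ω)).2)
    have hco : ∀ ω, (((min (V ω) C).toReal : ℝ) : EReal) = min (V ω) C := fun ω =>
      EReal.coe_toReal (ne_top_of_le_ne_top (EReal.coe_ne_top C) (min_le_right _ _))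
        (ne_bot_of_le_ne_bot (EReal.coe_ne_bot _) (hlow ω))
    have hUW : ∀ ω, U ω ≤ (min (V ω) C).toReal := fun ω => by
      rw [← EReal.coe_le_coe_iff, hco]
      exact hlow ω
    have hWC : ∀ ω, (min (V ω) C).toReal ≤ C := fun ω => by
      rw [← EReal.coe_le_coe_iff, hco]
      exact min_le_right _ _
    have hWm : Measurable fun ω => (min (V ω) C).toReal :=
      (hVm.min measurable_const).ereal_toReal
    have hWb : ∀ ω, |(min (V ω) C).toReal| ≤ C := fun ω =>
      abs_le.2 ⟨(abs_le.1 (hU ω)).1.trans (hUW ω), hWC ω⟩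
    calc ((C - (∫⁻ ω, ENNReal.ofReal (C - U ω) ∂μ).toReal : ℝ) : EReal)
        ≤ ((∫ ω, (min (V ω) C).toReal ∂μ : ℝ) : EReal) := by
          rw [integral_eq_sub_lintegral hWm hWb, EReal.coe_le_coe_iff]
          refine sub_le_sub_left (ENNReal.toReal_mono (lintegral_ofReal_const_sub_ne_top hU) ?_) _
          exact lintegral_mono fun ω => ENNReal.ofReal_le_ofReal (sub_le_sub_left (hUW ω) _)
      _ = extExpectation μ fun ω => (((min (V ω) C).toReal : ℝ) : EReal) :=
          (extExpectation_coe (integrable_of_abs_le hWm hWb)).symm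
      _ ≤ extExpectation μ V := extExpectation_mono fun ω => by
          rw [hco]
          exact min_le_left _ _

theorem upperMean_eq {U : Ω → ℝ} {C : ℝ} (hU : ∀ ω, |U ω| ≤ C) :
    upperMean μ U = C - (∫⁻ ω, ENNReal.ofReal (C - U ω) ∂μ).toReal := by
  rw [upperMean, outerExpectation_coe hU, EReal.toReal_coe]

theorem coe_upperMean {U : Ω → ℝ} {C : ℝ} (hU : ∀ ω, |U ω| ≤ C) :
    (upperMean μ U : EReal) = outerExpectation μ fun ω => (U ω : EReal) := by
  rw [upperMean, outerExpectation_coe hU, EReal.toReal_coe]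

theorem upperMean_mono_ae {U V : Ω → ℝ} {C D : ℝ} (hU : ∀ ω, |U ω| ≤ C) (hV : ∀ ω, |V ω| ≤ D)
    (h : ∀ᵐ ω ∂μ, U ω ≤ V ω) : upperMean μ U ≤ upperMean μ V := by
  have hU' : ∀ ω, |U ω| ≤ max C D := fun ω => (hU ω).trans (le_max_left _ _)
  have hV' : ∀ ω, |V ω| ≤ max C D := fun ω => (hV ω).trans (le_max_right _ _)
  rw [upperMean_eq hU', upperMean_eq hV']
  refine sub_le_sub_left (ENNReal.toReal_mono (lintegral_ofReal_const_sub_ne_top hU') ?_) _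
  refine lintegral_mono_ae ?_
  filter_upwards [h] with ω hω
  exact ENNReal.ofReal_le_ofReal (sub_le_sub_left hω _)

/-- The lower integral is superadditive on nonnegative functions; applying this to `C - U` and `D -
V` reverses the inequality. -/
theorem upperMean_add_le {U V : Ω → ℝ} {C D : ℝ} (hU : ∀ ω, |U ω| ≤ C) (hV : ∀ ω, |V ω| ≤ D) :
    upperMean μ (fun ω => U ω + V ω) ≤ upperMean μ U + upperMean μ V := by
  have hUV : ∀ ω, |U ω + V ω| ≤ C + D := fun ω =>
    (abs_add_le _ _).trans (add_le_add (hU ω) (hV ω))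
  have key : ∫⁻ ω, ENNReal.ofReal (C - U ω) ∂μ + ∫⁻ ω, ENNReal.ofReal (D - V ω) ∂μ ≤
      ∫⁻ ω, ENNReal.ofReal (C + D - (U ω + V ω)) ∂μ := by
    refine (le_lintegral_add _ _).trans (lintegral_mono fun ω => ?_)
    rw [← ENNReal.ofReal_add (by linarith [abs_le.1 (hU ω)]) (by linarith [abs_le.1 (hV ω)])]
    exact ENNReal.ofReal_le_ofReal (by linarith)
  have key' := ENNReal.toReal_mono (lintegral_ofReal_const_sub_ne_top hUV) key
  rw [ENNReal.toReal_add (lintegral_ofReal_const_sub_ne_top hU)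
    (lintegral_ofReal_const_sub_ne_top hV)] at key'
  rw [upperMean_eq hU, upperMean_eq hV, upperMean_eq hUV]
  linarith

/-- The probability of a set is at most the outer expectation of any bounded function that
dominates its indicator. -/
theorem measure_toReal_le_upperMean {A : Set Ω} {V : Ω → ℝ} {C : ℝ} (hV : ∀ ω, |V ω| ≤ C)
    (h0 : ∀ ω, 0 ≤ V ω) (h1 : ∀ ω ∈ A, 1 ≤ V ω) : (μ A).toReal ≤ upperMean μ V := by
  have h2 : outerProb μ A ≤ upperMean μ V := by
    rw [coe_upperMean hV]
    refine sInf_le_sInf ?_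
    rintro a ⟨W, hWm, hW, hWe, rfl⟩
    refine ⟨W, hWm, fun ω => le_trans ?_ (hW ω), hWe, rfl⟩
    by_cases hω : ω ∈ A
    · rw [Set.indicator_of_mem hω]
      exact EReal.coe_le_coe_iff.2 (h1 ω hω)
    · rw [Set.indicator_of_notMem hω]
      exact EReal.coe_le_coe_iff.2 (h0 ω)
  rw [outerProb_eq, ← EReal.coe_ennreal_toReal (measure_ne_top μ A), EReal.coe_le_coe_iff] at h2
  exact h2

end UpperMean

/-! ### Weak convergence tested on monotone functions -/

theorem tendsto_of_forall_sandwich {u : ℕ → ℝ} {l : ℝ}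
    (h : ∀ η : ℝ, 0 < η → ∃ (v w : ℕ → ℝ) (a b : ℝ), Tendsto v atTop (𝓝 a) ∧
      Tendsto w atTop (𝓝 b) ∧ l - η ≤ a ∧ b ≤ l + η ∧
      (∀ᶠ n in atTop, v n ≤ u n) ∧ ∀ᶠ n in atTop, u n ≤ w n) :
    Tendsto u atTop (𝓝 l) := by
  rw [tendsto_order]
  constructor
  · intro c hc
    obtain ⟨v, w, a, b, hv, -, ha, -, hvu, -⟩ := h ((l - c) / 2) (by linarith)
    filter_upwards [hvu, hv.eventually_const_lt (show c < a by linarith)] with n h1 h2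
    linarith
  · intro c hc
    obtain ⟨v, w, a, b, -, hw, -, hb, -, huw⟩ := h ((c - l) / 2) (by linarith)
    filter_upwards [huw, hw.eventually_lt_const (show b < c by linarith)] with n h1 h2
    linarith

section UpperConv

variable {Ω Ω' E : Type*} [MeasurableSpace Ω] [MeasurableSpace Ω'] [TopologicalSpace E]

/-- Convergence `E* φ(Z_n) → E φ(G)` for a single test function. -/
def UpperConv (μ : Measure Ω) (Z : ℕ → Ω → E) (ν : Measure Ω') (G : Ω' → E) (φ : E →ᵇ ℝ) : Prop :=
  Tendsto (fun n => upperMean μ fun ω => φ (Z n ω)) atTop (𝓝 (∫ ω', φ (G ω') ∂ν))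

variable {μ : Measure Ω} {ν : Measure Ω'} {Z : ℕ → Ω → E} {G : Ω' → E}

theorem measurable_comp_of_borel {F : Type*} [TopologicalSpace F] (hG : Measurable[_, borel E] G)
    {g : E → F} (hg : Continuous g) : Measurable[_, borel F] fun ω' => g (G ω') := by
  borelize E F
  exact hg.measurable.comp hG

theorem HJWeakConv.comp_continuous {F : Type*} [TopologicalSpace F] (h : HJWeakConv μ Z ν G)
    {g : E → F} (hg : Continuous g) :
    HJWeakConv μ (fun n ω => g (Z n ω)) ν fun ω' => g (G ω') :=
  ⟨measurable_comp_of_borel h.1 hg, fun φ => h.2 (φ.compContinuous ⟨g, hg⟩)⟩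

variable [IsProbabilityMeasure μ]

theorem hjWeakConv_iff :
    HJWeakConv μ Z ν G ↔ Measurable[_, borel E] G ∧ ∀ φ, UpperConv μ Z ν G φ := by
  refine and_congr_right fun _ => forall_congr' fun φ => ?_
  rw [UpperConv, ← EReal.tendsto_coe]
  simp only [coe_upperMean (μ := μ) fun ω => φ.norm_coe_le_norm (Z _ ω)]

variable [IsProbabilityMeasure ν]

theorem integrable_bcf_comp (hG : Measurable[_, borel E] G) (φ : E →ᵇ ℝ) :
    Integrable (fun ω' => φ (G ω')) ν := by
  borelize E
  exact integrable_of_abs_le (φ.continuous.measurable.comp hG) fun ω' => φ.norm_coe_le_norm (G ω')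

theorem upperMean_bcf_le_add {W : Ω → E} {φ ψ χ : E →ᵇ ℝ} (h : ∀ x, φ x ≤ ψ x + χ x) :
    upperMean μ (fun ω => φ (W ω)) ≤
      upperMean μ (fun ω => ψ (W ω)) + upperMean μ (fun ω => χ (W ω)) :=
  (upperMean_mono_ae (fun ω => φ.norm_coe_le_norm (W ω))
    (fun ω => (ψ + χ).norm_coe_le_norm (W ω)) (Eventually.of_forall fun ω => h (W ω))).trans
    (upperMean_add_le (fun ω => ψ.norm_coe_le_norm (W ω)) fun ω => χ.norm_coe_le_norm (W ω))

/-- Outer expectation is only subadditive, so convergence for `φ` and `ψ` bounds the sum from above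
alone. The lower bound comes from `φ = (φ + ψ) + (-ψ)`, hence the third convergence. -/
theorem UpperConv.add (hG : Measurable[_, borel E] G) {φ ψ : E →ᵇ ℝ}
    (hφ : UpperConv μ Z ν G φ) (hψ : UpperConv μ Z ν G ψ) (hψ' : UpperConv μ Z ν G (-ψ)) :
    UpperConv μ Z ν G (φ + ψ) := by
  have h1 : ∫ ω', (φ + ψ) (G ω') ∂ν = ∫ ω', φ (G ω') ∂ν + ∫ ω', ψ (G ω') ∂ν :=
    integral_add (integrable_bcf_comp hG φ) (integrable_bcf_comp hG ψ)
  have h2 : ∫ ω', (-ψ) (G ω') ∂ν = -∫ ω', ψ (G ω') ∂ν := integral_neg _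
  have h3 := Tendsto.sub hφ hψ'
  rw [h2, sub_neg_eq_add, ← h1] at h3
  have h4 := Tendsto.add hφ hψ
  rw [← h1] at h4
  refine tendsto_of_tendsto_of_tendsto_of_le_of_le h3 h4 (fun n => ?_) fun n => ?_
  · exact sub_le_iff_le_add.2 (upperMean_bcf_le_add fun x => by simp)
  · exact upperMean_bcf_le_add fun x => le_rfl

/-- The error need not be uniformly small: it is dominated by a test function `b` whose outer
expectations also converge, to a small limit. -/
theorem UpperConv.of_approx (hG : Measurable[_, borel E] G) {φ : E →ᵇ ℝ}
    (h : ∀ η : ℝ, 0 < η → ∃ a b : E →ᵇ ℝ, UpperConv μ Z ν G a ∧ UpperConv μ Z ν G b ∧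
      (∀ x, |φ x - a x| ≤ b x) ∧ ∫ ω', b (G ω') ∂ν ≤ η) :
    UpperConv μ Z ν G φ := by
  refine tendsto_of_forall_sandwich fun η hη => ?_
  obtain ⟨a, b, ha, hb, hab, hbη⟩ := h (η / 2) (by linarith)
  have hint := integrable_bcf_comp (ν := ν) hG
  have h1 : ∫ ω', φ (G ω') ∂ν ≤ ∫ ω', a (G ω') ∂ν + ∫ ω', b (G ω') ∂ν := by
    rw [← integral_add (hint a) (hint b)]
    exact integral_mono (hint φ) ((hint a).add (hint b)) fun ω' => by
      have := abs_le.1 (hab (G ω'))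
      beta_reduce
      linarith
  have h2 : ∫ ω', a (G ω') ∂ν ≤ ∫ ω', φ (G ω') ∂ν + ∫ ω', b (G ω') ∂ν := by
    rw [← integral_add (hint φ) (hint b)]
    exact integral_mono (hint a) ((hint φ).add (hint b)) fun ω' => by
      have := abs_le.1 (hab (G ω'))
      beta_reduce
      linarith
  refine ⟨_, _, _, _, Tendsto.sub ha hb, Tendsto.add ha hb, by linarith, by linarith,
    Eventually.of_forall fun n => ?_, Eventually.of_forall fun n => ?_⟩
  · exact sub_le_iff_le_add.2 (upperMean_bcf_le_add fun x => by linarith [abs_le.1 (hab x)])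
  · exact upperMean_bcf_le_add fun x => by linarith [abs_le.1 (hab x)]

end UpperConv

/-- The continuous function that is `0` for `x ≤ K - 1`, is `1` for `K ≤ x`, and is affine between. -/
noncomputable def tailRamp (K : ℝ) : ℝ →ᵇ ℝ :=
  BoundedContinuousFunction.ofNormedAddCommGroup (fun x => max 0 (min 1 (x - K + 1)))
    (by fun_prop) 1 fun x => by
      rw [Real.norm_eq_abs, abs_le]
      exact ⟨by linarith [le_max_left 0 (min 1 (x - K + 1))],
        max_le zero_le_one (min_le_left _ _)⟩

theorem tailRamp_nonneg (K x : ℝ) : 0 ≤ tailRamp K x := le_max_left _ _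

theorem tailRamp_le_one (K x : ℝ) : tailRamp K x ≤ 1 := max_le zero_le_one (min_le_left _ _)

theorem abs_tailRamp_le_one (K x : ℝ) : |tailRamp K x| ≤ 1 := by
  rw [abs_of_nonneg (tailRamp_nonneg K x)]
  exact tailRamp_le_one K x

theorem one_le_tailRamp {K x : ℝ} (h : K ≤ x) : 1 ≤ tailRamp K x :=
  le_max_of_le_right (le_min le_rfl (by linarith))

theorem tailRamp_eq_zero {K x : ℝ} (h : x ≤ K - 1) : tailRamp K x = 0 :=
  max_eq_left ((min_le_right _ _).trans (by linarith))

theorem monotone_tailRamp (K : ℝ) : Monotone (tailRamp K) := fun x y h =>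
  max_le_max le_rfl (min_le_min le_rfl (by linarith))

/-- The tail ramps of a real random variable have expectations tending to zero. -/
theorem tendsto_integral_tailRamp {Ω' : Type*} [MeasurableSpace Ω'] {ν : Measure Ω'}
    [IsProbabilityMeasure ν] {L : Ω' → ℝ} (hL : Measurable L) :
    Tendsto (fun K : ℕ => ∫ ω', tailRamp K (L ω') ∂ν) atTop (𝓝 0) := by
  have h := tendsto_integral_of_dominated_convergence (μ := ν)
    (F := fun (K : ℕ) ω' => tailRamp K (L ω')) (f := fun _ => (0 : ℝ)) (fun _ => (1 : ℝ))
    (fun K => ((tailRamp K).continuous.measurable.comp hL).aestronglyMeasurable)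
    (integrable_const 1) (fun K => Eventually.of_forall fun ω' => abs_tailRamp_le_one K (L ω'))
    (Eventually.of_forall fun ω' => ?_)
  · simpa using h
  · refine tendsto_const_nhds.congr' ?_
    obtain ⟨N, hN⟩ := exists_nat_ge (L ω' + 1)
    filter_upwards [eventually_ge_atTop N] with K hK
    have : (N : ℝ) ≤ K := by exact_mod_cast hK
    exact (tailRamp_eq_zero (by linarith)).symm

/-- Truncation of the real line to `[-K, K]`. -/
noncomputable def truncate (K : ℝ) (x : ℝ) : ℝ := max (-K) (min K x)

theorem continuous_truncate (K : ℝ) : Continuous (truncate K) := by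
  unfold truncate
  fun_prop

theorem monotone_truncate (K : ℝ) : Monotone (truncate K) := fun _ _ h =>
  max_le_max le_rfl (min_le_min le_rfl h)

theorem truncate_mem_Icc {K : ℝ} (hK : 0 ≤ K) (x : ℝ) : truncate K x ∈ Set.Icc (-K) K :=
  ⟨le_max_left _ _, max_le (by linarith) (min_le_left _ _)⟩

theorem truncate_eq_self {K x : ℝ} (h : x ∈ Set.Icc (-K) K) : truncate K x = x := by
  rw [truncate, min_eq_right h.2, max_eq_right h.1]

/-- On a compact interval a polynomial becomes monotone after adding a large multiple of `x`. -/
theorem Polynomial.exists_monotoneOn_add_mul (p : Polynomial ℝ) (K : ℝ) :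
    ∃ A : ℝ, 0 ≤ A ∧ MonotoneOn (fun x => p.eval x + A * x) (Set.Icc (-K) K) := by
  obtain ⟨A, hA⟩ := isCompact_Icc.exists_bound_of_continuousOn (s := Set.Icc (-K) K)
    (f := fun x => p.derivative.eval x) p.derivative.continuous.continuousOn
  refine ⟨max A 0, le_max_right _ _, ?_⟩
  have hd : ∀ x, HasDerivAt (fun x => p.eval x + max A 0 * x)
      (p.derivative.eval x + max A 0) x := fun x => by
    have h := (p.hasDerivAt x).fun_add ((hasDerivAt_id' x).const_mul (max A 0))
    rwa [mul_one] at h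
  refine monotoneOn_of_deriv_nonneg (convex_Icc _ _)
    (fun x _ => (hd x).continuousAt.continuousWithinAt)
    (fun x _ => (hd x).differentiableAt.differentiableWithinAt) fun x hx => ?_
  rw [(hd x).deriv]
  have h1 := abs_le.1 (hA x (interior_subset hx))
  linarith [le_max_left A 0]

section Real

variable {Ω Ω' : Type*} [MeasurableSpace Ω] [MeasurableSpace Ω']
  {μ : Measure Ω} {ν : Measure Ω'} [IsProbabilityMeasure μ] [IsProbabilityMeasure ν]
  {W : ℕ → Ω → ℝ} {L : Ω' → ℝ}

/-- For real limits it suffices to test weak convergence on bounded continuous functions that are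
monotone or antitone. -/
theorem hjWeakConv_of_monotone_antitone (hL : Measurable L)
    (hmono : ∀ g : ℝ →ᵇ ℝ, Monotone g → UpperConv μ W ν L g)
    (hanti : ∀ g : ℝ →ᵇ ℝ, Antitone g → UpperConv μ W ν L g) :
    HJWeakConv μ W ν L := by
  have hL' : Measurable[_, borel ℝ] L := by
    rwa [← BorelSpace.measurable_eq (α := ℝ)]
  refine hjWeakConv_iff.2 ⟨hL', fun φ => UpperConv.of_approx hL' fun η hη => ?_⟩
  have hsum : ∀ g k : ℝ →ᵇ ℝ, Monotone g → Antitone k → UpperConv μ W ν L (g + k) :=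
    fun g k hg hk => (hmono g hg).add hL' (hanti k hk) (hmono (-k) fun x y h => by
      simpa using hk h)
  -- `C` bounds the oscillation of `φ`, so `C` times a tail ramp pays for truncation.
  set C : ℝ := 2 * ‖φ‖ with hC
  have hC0 : 0 ≤ C := by positivity
  obtain ⟨K, hK⟩ : ∃ K : ℕ,
      C * (∫ ω', tailRamp K (L ω') ∂ν + ∫ ω', tailRamp K (-L ω') ∂ν) < η / 2 := by
    have h := ((tendsto_integral_tailRamp (ν := ν) hL).add
      (tendsto_integral_tailRamp (ν := ν) hL.neg)).const_mul C
    rw [add_zero, mul_zero] at h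
    exact (h.eventually_lt_const (by linarith : (0 : ℝ) < η / 2)).exists
  have hK0 : (0 : ℝ) ≤ K := K.cast_nonneg
  obtain ⟨p, hp⟩ := exists_polynomial_near_of_continuousOn (-(K : ℝ)) K φ
    φ.continuous.continuousOn (η / 2) (by linarith)
  obtain ⟨A, hA, hpA⟩ := p.exists_monotoneOn_add_mul (K : ℝ)
  obtain ⟨B, hB⟩ := isCompact_Icc.exists_bound_of_continuousOn (s := Set.Icc (-(K : ℝ)) K)
    (f := fun x => p.eval x + A * x) (by fun_prop)
  have htc := continuous_truncate K
  -- The truncated polynomial is split as `g + k`: adding `A x` makes it monotone, and subtracting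
  -- it back is antitone.
  let g : ℝ →ᵇ ℝ := BoundedContinuousFunction.ofNormedAddCommGroup
    (fun x => p.eval (truncate K x) + A * truncate K x) (by fun_prop) B
    fun x => hB _ (truncate_mem_Icc hK0 x)
  let k : ℝ →ᵇ ℝ := BoundedContinuousFunction.ofNormedAddCommGroup
    (fun x => -(A * truncate K x)) (by fun_prop) (A * K) fun x => by
      rw [norm_neg, norm_mul, Real.norm_eq_abs, Real.norm_eq_abs, abs_of_nonneg hA]
      exact mul_le_mul_of_nonneg_left (abs_le.2 (truncate_mem_Icc hK0 x)) hA
  -- The error bound `r + s` has the same shape: `r` covers the right tail and the polynomial error,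
  -- `s` the left tail.
  let r : ℝ →ᵇ ℝ := C • tailRamp K + BoundedContinuousFunction.const ℝ (η / 2)
  let s : ℝ →ᵇ ℝ := C • (tailRamp K).compContinuous ⟨fun x => -x, continuous_neg⟩
  have hrx : ∀ x, r x = C * tailRamp K x + η / 2 := fun x => rfl
  have hsx : ∀ x, s x = C * tailRamp K (-x) := fun x => rfl
  refine ⟨g + k, r + s, hsum g k ?_ ?_, hsum r s ?_ ?_, fun x => ?_, ?_⟩
  · exact fun x y h => hpA (truncate_mem_Icc hK0 x) (truncate_mem_Icc hK0 y)
      (monotone_truncate K h)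
  · exact fun x y h => neg_le_neg (mul_le_mul_of_nonneg_left (monotone_truncate K h) hA)
  · intro x y h
    rw [hrx, hrx]
    linarith [mul_le_mul_of_nonneg_left (monotone_tailRamp K h) hC0]
  · intro x y h
    rw [hsx, hsx]
    exact mul_le_mul_of_nonneg_left (monotone_tailRamp K (neg_le_neg h)) hC0
  · have h1 : (g + k) x = p.eval (truncate K x) :=
      add_neg_cancel_right (p.eval (truncate K x)) (A * truncate K x)
    have h2 := hp _ (truncate_mem_Icc hK0 x)
    have h3 : |φ x - φ (truncate K x)| ≤ C * tailRamp K x + C * tailRamp K (-x) := by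
      have h4 := mul_nonneg hC0 (tailRamp_nonneg K x)
      have h5 := mul_nonneg hC0 (tailRamp_nonneg K (-x))
      have h6 : |φ x - φ (truncate K x)| ≤ C := φ.dist_le_two_norm x (truncate K x)
      by_cases hx : x ∈ Set.Icc (-(K : ℝ)) K
      · rw [truncate_eq_self hx, sub_self, abs_zero]
        positivity
      · rcases lt_or_ge x (-(K : ℝ)) with hx1 | hx1
        · have h7 := mul_le_mul_of_nonneg_left (one_le_tailRamp (K := K) (x := -x) (by linarith)) hC0
          linarith
        · have hx2 : (K : ℝ) ≤ x := by
            by_contra hx2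
            exact hx ⟨hx1, (not_le.1 hx2).le⟩
          have h7 := mul_le_mul_of_nonneg_left (one_le_tailRamp hx2) hC0
          linarith
    rw [h1, BoundedContinuousFunction.add_apply, hrx, hsx]
    rw [abs_lt] at h2
    rw [abs_le] at h3 ⊢
    constructor <;> linarith
  · have i1 := integrable_bcf_comp (ν := ν) hL' (tailRamp K)
    have i2 : Integrable (fun ω' => tailRamp K (-L ω')) ν := integrable_bcf_comp hL'
      ((tailRamp K).compContinuous ⟨fun x => -x, continuous_neg⟩)
    simp only [BoundedContinuousFunction.add_apply, hrx, hsx]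
    have i3 : Integrable (fun ω' => C * tailRamp K (L ω') + η / 2) ν :=
      (i1.const_mul C).add (integrable_const _)
    rw [integral_add i3 (i2.const_mul C),
      integral_add (i1.const_mul C) (integrable_const _), integral_const_mul, integral_const_mul]
    simp only [integral_const, probReal_univ, one_smul]
    linarith

/-- A monotone delta method: if continuous functionals `Φ_m` increase pointwise to a continuous
functional `Λ`, and eventually `Φ_m(Z_n) ≤ W_n ≤ Λ(Z_n)` almost surely, then `Z_n ⇝ G` implies
`W_n ⇝ Λ(G)`. No separability or tightness of `G` is needed. -/
theorem HJWeakConv.of_monotone_approx {E : Type*} [TopologicalSpace E] {Z : ℕ → Ω → E}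
    {G : Ω' → E} (hZ : HJWeakConv μ Z ν G) {Φ : ℕ → E → ℝ} {Λ : E → ℝ}
    (hΦ : ∀ m, Continuous (Φ m)) (hΛ : Continuous Λ)
    (hlim : ∀ z, Tendsto (fun m => Φ m z) atTop (𝓝 (Λ z)))
    (hlow : ∀ m, ∀ᶠ n in atTop, ∀ᵐ ω ∂μ, Φ m (Z n ω) ≤ W n ω)
    (hupp : ∀ᶠ n in atTop, ∀ᵐ ω ∂μ, W n ω ≤ Λ (Z n ω)) :
    HJWeakConv μ W ν fun ω' => Λ (G ω') := by
  obtain ⟨hG, hZ⟩ := hjWeakConv_iff.1 hZ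
  have hL : Measurable fun ω' => Λ (G ω') := by
    borelize E
    exact hΛ.measurable.comp hG
  have conv : ∀ (g : ℝ →ᵇ ℝ) {Ψ : E → ℝ}, Continuous Ψ →
      Tendsto (fun n => upperMean μ fun ω => g (Ψ (Z n ω))) atTop (𝓝 (∫ ω', g (Ψ (G ω')) ∂ν)) :=
    fun g Ψ hΨ => hZ (g.compContinuous ⟨Ψ, hΨ⟩)
  have dct : ∀ (g : ℝ →ᵇ ℝ) (η : ℝ), 0 < η → ∃ m,
      |∫ ω', g (Φ m (G ω')) ∂ν - ∫ ω', g (Λ (G ω')) ∂ν| < η := by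
    intro g η hη
    have h : Tendsto (fun m => ∫ ω', g (Φ m (G ω')) ∂ν) atTop (𝓝 (∫ ω', g (Λ (G ω')) ∂ν)) :=
      tendsto_integral_of_dominated_convergence (fun _ => ‖g‖)
        (fun m => (integrable_bcf_comp hG
          (g.compContinuous ⟨Φ m, hΦ m⟩)).aestronglyMeasurable) (integrable_const _)
        (fun m => Eventually.of_forall fun ω' => g.norm_coe_le_norm _)
        (Eventually.of_forall fun ω' => (g.continuous.tendsto _).comp (hlim (G ω')))
    exact (h.eventually (Metric.ball_mem_nhds _ hη)).exists
  refine hjWeakConv_of_monotone_antitone hL (fun g hg => ?_) fun g hg => ?_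
  · refine tendsto_of_forall_sandwich fun η hη => ?_
    obtain ⟨m, hm⟩ := dct g η hη
    rw [abs_lt] at hm
    refine ⟨_, _, _, _, conv g (hΦ m), conv g hΛ, by linarith, by linarith, ?_, ?_⟩
    · filter_upwards [hlow m] with n hn
      exact upperMean_mono_ae (fun ω => g.norm_coe_le_norm _) (fun ω => g.norm_coe_le_norm _)
        (hn.mono fun ω h => hg h)
    · filter_upwards [hupp] with n hn
      exact upperMean_mono_ae (fun ω => g.norm_coe_le_norm _) (fun ω => g.norm_coe_le_norm _)
        (hn.mono fun ω h => hg h)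
  -- An antitone `g` swaps the two sides: `Λ` now gives the lower bound and `Φ m` the upper one.
  · refine tendsto_of_forall_sandwich fun η hη => ?_
    obtain ⟨m, hm⟩ := dct g η hη
    rw [abs_lt] at hm
    refine ⟨_, _, _, _, conv g hΛ, conv g (hΦ m), by linarith, by linarith, ?_, ?_⟩
    · filter_upwards [hupp] with n hn
      exact upperMean_mono_ae (fun ω => g.norm_coe_le_norm _) (fun ω => g.norm_coe_le_norm _)
        (hn.mono fun ω h => hg h)
    · filter_upwards [hlow m] with n hn
      exact upperMean_mono_ae (fun ω => g.norm_coe_le_norm _) (fun ω => g.norm_coe_le_norm _)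
        (hn.mono fun ω h => hg h)

end Real

/-! ### The infimum functional on `ℓ^∞(X)` -/

section PenalizedInf

variable {X : Type*} {f : X → ℝ}

/-- The difference quotient of the infimum functional at `f` in the direction `z`, with step `1/c`. -/
noncomputable def penalizedInf (f : X → ℝ) (c : ℝ) (z : EllInfty X) : ℝ :=
  ⨅ x, (c * (f x - infVal f) + z x)

/-- The directional derivative of the infimum functional at `f` in the direction `z`. -/
noncomputable def infDeriv (f : X → ℝ) (z : EllInfty X) : ℝ :=
  ⨆ m : ℕ, penalizedInf f (√(m : ℝ)) z

theorem EllInfty.abs_apply_le_norm (z : EllInfty X) (x : X) : |z x| ≤ ‖z‖ :=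
  lp.norm_apply_le_norm ENNReal.top_ne_zero z x

theorem infVal_le (hf : BddBelow (Set.range f)) (x : X) : infVal f ≤ f x := ciInf_le hf x

theorem bddBelow_subtype (s : Set X) (z : EllInfty X) :
    BddBelow (Set.range fun x : s => z (x : X)) :=
  ⟨-‖z‖, by
    rintro _ ⟨x, rfl⟩
    exact (abs_le.1 (z.abs_apply_le_norm x)).1⟩

theorem neg_norm_le_penalized (hf : BddBelow (Set.range f)) {c : ℝ} (hc : 0 ≤ c)
    (z : EllInfty X) (x : X) : -‖z‖ ≤ c * (f x - infVal f) + z x := by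
  have h1 := mul_nonneg hc (sub_nonneg.2 (infVal_le hf x))
  have h2 := abs_le.1 (z.abs_apply_le_norm x)
  linarith

theorem penalizedInf_le_apply (hf : BddBelow (Set.range f)) {c : ℝ} (hc : 0 ≤ c)
    (z : EllInfty X) (x : X) : penalizedInf f c z ≤ c * (f x - infVal f) + z x :=
  ciInf_le ⟨-‖z‖, by
    rintro _ ⟨x, rfl⟩
    exact neg_norm_le_penalized hf hc z x⟩ x

theorem lipschitzWith_of_le_add_norm {Φ : EllInfty X → ℝ} (h : ∀ z w, Φ z ≤ Φ w + ‖z - w‖) :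
    LipschitzWith 1 Φ :=
  LipschitzWith.of_le_add fun z w => by
    rw [dist_eq_norm]
    exact h z w

variable [Nonempty X]

theorem nearMin_nonempty {ε : ℝ} (hε : 0 < ε) : (nearMin f ε).Nonempty := by
  obtain ⟨x, hx⟩ := exists_lt_of_ciInf_lt (show ⨅ x, f x < infVal f + ε from lt_add_of_pos_right _ hε)
  exact ⟨x, hx.le⟩

theorem neg_norm_le_penalizedInf (hf : BddBelow (Set.range f)) {c : ℝ} (hc : 0 ≤ c)
    (z : EllInfty X) : -‖z‖ ≤ penalizedInf f c z :=
  le_ciInf (neg_norm_le_penalized hf hc z)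

theorem penalizedInf_mono (hf : BddBelow (Set.range f)) {c d : ℝ} (hc : 0 ≤ c) (hcd : c ≤ d)
    (z : EllInfty X) : penalizedInf f c z ≤ penalizedInf f d z :=
  le_ciInf fun x => (penalizedInf_le_apply hf hc z x).trans <| by
    have := mul_le_mul_of_nonneg_right hcd (sub_nonneg.2 (infVal_le hf x))
    linarith

theorem penalizedInf_le_add (hf : BddBelow (Set.range f)) {c : ℝ} (hc : 0 ≤ c)
    (z w : EllInfty X) : penalizedInf f c z ≤ penalizedInf f c w + ‖z - w‖ := by
  rw [← sub_le_iff_le_add]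
  refine le_ciInf fun x => ?_
  have h1 := penalizedInf_le_apply hf hc z x
  have h2 : z x - w x ≤ ‖z - w‖ := (le_abs_self _).trans ((z - w).abs_apply_le_norm x)
  linarith

theorem continuous_penalizedInf (hf : BddBelow (Set.range f)) {c : ℝ} (hc : 0 ≤ c) :
    Continuous (penalizedInf f c) :=
  (lipschitzWith_of_le_add_norm (penalizedInf_le_add hf hc)).continuous

/-- On the near-minimal set the penalty is at most `c * ε`. -/
theorem penalizedInf_le_add_iInf_nearMin (hf : BddBelow (Set.range f)) {c ε : ℝ} (hc : 0 ≤ c)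
    (hε : 0 < ε) (z : EllInfty X) :
    penalizedInf f c z ≤ c * ε + ⨅ x : nearMin f ε, z (x : X) := by
  have := (nearMin_nonempty (f := f) hε).to_subtype
  rw [← sub_le_iff_le_add']
  refine le_ciInf fun x => ?_
  have h1 := penalizedInf_le_apply hf hc z x
  have h2 : f x ≤ infVal f + ε := x.2
  have h3 := mul_le_mul_of_nonneg_left (show f x - infVal f ≤ ε by linarith) hc
  linarith

theorem iInf_nearMin_le_norm {ε : ℝ} (hε : 0 < ε) (z : EllInfty X) :
    ⨅ x : nearMin f ε, z (x : X) ≤ ‖z‖ := by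
  obtain ⟨x, hx⟩ := nearMin_nonempty (f := f) hε
  exact (ciInf_le (bddBelow_subtype _ z) ⟨x, hx⟩).trans (abs_le.1 (z.abs_apply_le_norm x)).2

/-- Off the near-minimal set the penalty is at least `c * ε ≥ 2 * ‖z‖`, so the penalized value is at
least `‖z‖` and cannot undercut the infimum over that set. -/
theorem iInf_nearMin_le_penalizedInf (hf : BddBelow (Set.range f)) {c ε : ℝ} (hc : 0 ≤ c)
    (hε : 0 < ε) {z : EllInfty X} (hz : 2 * ‖z‖ ≤ c * ε) :
    ⨅ x : nearMin f ε, z (x : X) ≤ penalizedInf f c z := by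
  refine le_ciInf fun x => ?_
  by_cases hx : x ∈ nearMin f ε
  · have h1 : ⨅ x : nearMin f ε, z (x : X) ≤ z x := ciInf_le (bddBelow_subtype _ z) ⟨x, hx⟩
    have h2 := mul_nonneg hc (sub_nonneg.2 (infVal_le hf x))
    linarith
  · have h1 := iInf_nearMin_le_norm (f := f) hε z
    have h2 : infVal f + ε < f x := not_le.1 hx
    have h3 := mul_le_mul_of_nonneg_left (show ε ≤ f x - infVal f by linarith) hc
    have h4 := abs_le.1 (z.abs_apply_le_norm x)
    linarith

theorem penalizedInf_le_norm (hf : BddBelow (Set.range f)) {c : ℝ} (hc : 0 ≤ c)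
    (z : EllInfty X) : penalizedInf f c z ≤ ‖z‖ := by
  refine le_of_forall_pos_le_add fun η hη => ?_
  -- An exact minimizer may not exist, so near-minimizers are used; `c + 1` allows `c = 0`.
  have hε : 0 < η / (c + 1) := by positivity
  have h1 := penalizedInf_le_add_iInf_nearMin hf hc hε z
  have h2 := iInf_nearMin_le_norm (f := f) hε z
  have h3 : c * (η / (c + 1)) ≤ η := by
    rw [← mul_div_assoc, div_le_iff₀ (by positivity)]
    nlinarith
  linarith

theorem bddAbove_penalizedInf (hf : BddBelow (Set.range f)) (z : EllInfty X) :
    BddAbove (Set.range fun m : ℕ => penalizedInf f (√(m : ℝ)) z) :=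
  ⟨‖z‖, by
    rintro _ ⟨m, rfl⟩
    exact penalizedInf_le_norm hf (Real.sqrt_nonneg _) z⟩

theorem penalizedInf_le_infDeriv (hf : BddBelow (Set.range f)) (m : ℕ) (z : EllInfty X) :
    penalizedInf f (√(m : ℝ)) z ≤ infDeriv f z :=
  le_ciSup (bddAbove_penalizedInf hf z) m

theorem tendsto_penalizedInf (hf : BddBelow (Set.range f)) (z : EllInfty X) :
    Tendsto (fun m : ℕ => penalizedInf f (√(m : ℝ)) z) atTop (𝓝 (infDeriv f z)) :=
  tendsto_atTop_ciSup (fun _ _ h => penalizedInf_mono hf (Real.sqrt_nonneg _)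
    (Real.sqrt_le_sqrt (by exact_mod_cast h)) z) (bddAbove_penalizedInf hf z)

theorem continuous_infDeriv (hf : BddBelow (Set.range f)) : Continuous (infDeriv f) :=
  (lipschitzWith_of_le_add_norm fun z w => ciSup_le fun m =>
    (penalizedInf_le_add hf (Real.sqrt_nonneg _) z w).trans
      (add_le_add_left (penalizedInf_le_infDeriv hf m w) _)).continuous

theorem iInf_nearMin_le_infDeriv (hf : BddBelow (Set.range f)) {ε : ℝ} (hε : 0 < ε)
    (z : EllInfty X) : ⨅ x : nearMin f ε, z (x : X) ≤ infDeriv f z := by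
  have h : Tendsto (fun m : ℕ => √(m : ℝ)) atTop atTop :=
    Real.tendsto_sqrt_atTop.comp tendsto_natCast_atTop_atTop
  obtain ⟨m, hm⟩ := (h.eventually_ge_atTop (2 * ‖z‖ / ε)).exists
  exact (iInf_nearMin_le_penalizedInf hf (Real.sqrt_nonneg _) hε ((div_le_iff₀ hε).1 hm)).trans
    (penalizedInf_le_infDeriv hf m z)

/-- `infDeriv f z` bounds every infimum over a near-minimal set. Conversely such an infimum is at
least `penalizedInf f (√m) z - √m * ε`: fix `m` with the first term close to the supremum, then let
`ε ↓ 0`. -/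
theorem tendsto_iInf_nearMin (hf : BddBelow (Set.range f)) (z : EllInfty X) :
    Tendsto (fun ε : ℝ => ⨅ x : nearMin f ε, z (x : X)) (𝓝[>] 0) (𝓝 (infDeriv f z)) := by
  rw [tendsto_order]
  constructor
  · intro a ha
    obtain ⟨m, hm⟩ := ((tendsto_penalizedInf hf z).eventually_const_lt ha).exists
    have h1 : Tendsto (fun ε : ℝ => penalizedInf f (√(m : ℝ)) z - √(m : ℝ) * ε) (𝓝[>] 0)
        (𝓝 (penalizedInf f (√(m : ℝ)) z - √(m : ℝ) * 0)) :=
      (tendsto_const_nhds.sub (tendsto_id.const_mul _)).mono_left nhdsWithin_le_nhds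
    rw [mul_zero, sub_zero] at h1
    filter_upwards [h1.eventually_const_lt hm, self_mem_nhdsWithin] with ε h2 hε
    have h3 := penalizedInf_le_add_iInf_nearMin hf (Real.sqrt_nonneg (m : ℝ)) hε z
    linarith
  · intro b hb
    filter_upwards [self_mem_nhdsWithin] with ε hε
    exact (iInf_nearMin_le_infDeriv hf hε z).trans_lt hb

/-- Along `z = c (g - f)` the difference quotient is `c` times the difference of the infima. -/
theorem penalizedInf_eq_mul_sub {g : X → ℝ} (hf : BddBelow (Set.range f))
    (hg : BddBelow (Set.range g)) {c : ℝ} (hc : 0 < c) {z : EllInfty X}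
    (hz : ∀ x, z x = c * (g x - f x)) :
    penalizedInf f c z = c * (infVal g - infVal f) := by
  apply le_antisymm
  · have h : penalizedInf f c z / c + infVal f ≤ infVal g := le_ciInf fun x => by
      have h1 := penalizedInf_le_apply hf hc.le z x
      rw [hz x] at h1
      rw [← le_sub_iff_add_le, div_le_iff₀ hc]
      linarith
    rw [← le_sub_iff_add_le, div_le_iff₀ hc] at h
    linarith
  · refine le_ciInf fun x => ?_
    rw [hz x]
    have h1 := mul_le_mul_of_nonneg_left (infVal_le hg x) hc.le
    linarith

end PenalizedInf

theorem toEllInfty_apply {X : Type*} {g : X → ℝ} (hg : Memℓp g ⊤) (x : X) :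
    toEllInfty g x = g x := by
  rw [toEllInfty, dif_pos hg]

theorem Memℓp.bddBelow_range {X : Type*} {g : X → ℝ} (hg : Memℓp g ⊤) :
    BddBelow (Set.range g) := by
  obtain ⟨C, hC⟩ := memℓp_infty_iff.1 hg
  refine ⟨-C, ?_⟩
  rintro _ ⟨x, rfl⟩
  exact (abs_le.1 (hC ⟨x, rfl⟩)).1

/-! ### Boundedness in outer probability -/

section BigO

variable {Ω Ω' E : Type*} [MeasurableSpace Ω] [MeasurableSpace Ω'] {μ : Measure Ω}
  [IsProbabilityMeasure μ]

theorem outerProb_le_coe_iff {A : Set Ω} {a : ℝ} :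
    outerProb μ A ≤ (a : EReal) ↔ μ.real A ≤ a := by
  rw [outerProb_eq, ← EReal.coe_ennreal_toReal (measure_ne_top μ A), EReal.coe_le_coe_iff]
  rfl

theorem isBigOPStar_iff {U : ℕ → Ω → ℝ} {r : ℕ → ℝ} :
    IsBigOPStar μ U r ↔
      ∀ ε : ℝ, 0 < ε → ∃ M : ℝ, ∀ᶠ n in atTop, μ.real {ω | M * r n < |U n ω|} ≤ ε := by
  constructor
  · intro h ε hε
    -- Halving `ε` gives the strict limsup bound needed for an eventual inequality.
    obtain ⟨M, hM⟩ := h (ε / 2) (by linarith)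
    refine ⟨M, ?_⟩
    have h1 := hM.trans_lt (EReal.coe_lt_coe_iff.2 (show ε / 2 < ε by linarith))
    filter_upwards [eventually_lt_of_limsup_lt h1] with n hn
    exact outerProb_le_coe_iff.1 hn.le
  · intro h ε hε
    obtain ⟨M, hM⟩ := h ε hε
    exact ⟨M, limsup_le_of_le (h := hM.mono fun n hn => outerProb_le_coe_iff.2 hn)⟩

/-- The norm is continuous, so the question reduces to the tail of the single real random variable
`‖G‖`; a tail ramp dominates the indicator of the tail event. -/
theorem HJWeakConv.exists_eventually_norm_le [NormedAddCommGroup E] {ν : Measure Ω'}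
    [IsProbabilityMeasure ν] {Z : ℕ → Ω → E} {G : Ω' → E} (h : HJWeakConv μ Z ν G)
    {ε : ℝ} (hε : 0 < ε) :
    ∃ M : ℝ, 0 ≤ M ∧ ∀ᶠ n in atTop, μ.real {ω | M < ‖Z n ω‖} ≤ ε := by
  have hn := hjWeakConv_iff.1 (h.comp_continuous continuous_norm)
  have hL : Measurable fun ω' => ‖G ω'‖ := by
    borelize E
    exact continuous_norm.measurable.comp h.1
  obtain ⟨K, hK⟩ := ((tendsto_integral_tailRamp (ν := ν) hL).eventually_lt_const hε).exists
  refine ⟨K, K.cast_nonneg, ?_⟩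
  filter_upwards [(hn.2 (tailRamp K)).eventually_lt_const hK] with n hn
  exact (measure_toReal_le_upperMean (fun ω => abs_tailRamp_le_one K _)
    (fun ω => tailRamp_nonneg K _) fun ω hω => one_le_tailRamp hω.le).trans hn.le

/-- A sequence dominated by an affine function of the norms of a weakly convergent sequence, off
sets of vanishing probability, is bounded in outer probability. -/
theorem HJWeakConv.isBigOPStar_of_le [NormedAddCommGroup E] {ν : Measure Ω'}
    [IsProbabilityMeasure ν] {Z : ℕ → Ω → E} {G : Ω' → E} (h : HJWeakConv μ Z ν G)
    {U : ℕ → Ω → ℝ} {r : ℕ → ℝ} (hr : ∀ n, 0 ≤ r n) {a C : ℝ} (ha : 0 ≤ a) {B : ℕ → Set Ω}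
    (hB : Tendsto (fun n => μ.real (B n)) atTop (𝓝 0))
    (hU : ∀ᶠ n in atTop, ∀ᵐ ω ∂μ, ω ∉ B n → |U n ω| ≤ (a * ‖Z n ω‖ + C) * r n) :
    IsBigOPStar μ U r := by
  refine isBigOPStar_iff.2 fun ε hε => ?_
  obtain ⟨M, -, hM⟩ := h.exists_eventually_norm_le (half_pos hε)
  refine ⟨a * M + C, ?_⟩
  filter_upwards [hM, hU, hB.eventually_lt_const (half_pos hε)] with n h1 h2 h3
  have h4 : μ {ω | (a * M + C) * r n < |U n ω|} ≤ μ ({ω | M < ‖Z n ω‖} ∪ B n) := by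
    refine measure_mono_ae ?_
    filter_upwards [h2] with ω hω hlt
    by_contra hnot
    obtain ⟨h5, h6⟩ := not_or.1 hnot
    have h7 : ‖Z n ω‖ ≤ M := not_lt.1 h5
    have h8 : (a * M + C) * r n < |U n ω| := hlt
    have h9 := mul_le_mul_of_nonneg_right
      (add_le_add_left (mul_le_mul_of_nonneg_left h7 ha) C) (hr n)
    linarith [hω h6]
  have h5 : μ.real {ω | (a * M + C) * r n < |U n ω|} ≤ μ.real ({ω | M < ‖Z n ω‖} ∪ B n) :=
    ENNReal.toReal_mono (measure_ne_top _ _) h4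
  linarith [measureReal_union_le (μ := μ) {ω | M < ‖Z n ω‖} (B n)]

theorem IsBigOPStar.of_growth {U V : ℕ → Ω → ℝ} {β : ℝ}
    (hU : IsBigOPStar μ U fun n => (n : ℝ) ^ (-β)) {κ α : ℝ} (hκ : 1 ≤ κ) (hα : 0 < α)
    (hV : ∀ n ω, 0 ≤ V n ω) (hVU : ∀ n ω, α * V n ω ^ κ ≤ U n ω) :
    IsBigOPStar μ V fun n => (n : ℝ) ^ (-(β / κ)) := by
  have hκ0 : 0 < κ := by linarith
  refine isBigOPStar_iff.2 fun ε hε => ?_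
  obtain ⟨M, hM⟩ := isBigOPStar_iff.1 hU ε hε
  -- This solves `α v ^ κ = |M| n ^ (-β)` for `v`; the absolute value is there because `M` may be
  -- negative.
  refine ⟨(|M| / α) ^ κ⁻¹, ?_⟩
  filter_upwards [hM] with n hn
  refine (measureReal_mono fun ω hω => ?_).trans hn
  have h1 : (|M| / α) ^ κ⁻¹ * (n : ℝ) ^ (-(β / κ)) < V n ω := by
    simpa [abs_of_nonneg (hV n ω)] using hω
  have hnn : (0 : ℝ) ≤ n := n.cast_nonneg
  have h2 := Real.rpow_lt_rpow (by positivity) h1 hκ0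
  rw [Real.mul_rpow (by positivity) (by positivity), ← Real.rpow_mul (by positivity),
    ← Real.rpow_mul hnn, inv_mul_cancel₀ hκ0.ne', Real.rpow_one,
    neg_mul, div_mul_cancel₀ _ hκ0.ne', div_mul_eq_mul_div, div_lt_iff₀ hα] at h2
  have h3 : M * (n : ℝ) ^ (-β) ≤ |M| * (n : ℝ) ^ (-β) :=
    mul_le_mul_of_nonneg_right (le_abs_self M) (by positivity)
  have h4 := hVU n ω
  have h5 := le_abs_self (U n ω)
  show M * (n : ℝ) ^ (-β) < |U n ω|
  linarith

end BigO

/-! ### Empirical minimization -/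

/-- At `n = 0` both sides take the default value `0`. -/
theorem rpow_neg_half_eq (n : ℕ) : (n : ℝ) ^ (-(1 / 2) : ℝ) = (√(n : ℝ))⁻¹ := by
  rw [Real.rpow_neg n.cast_nonneg, Real.sqrt_eq_rpow]

theorem tendsto_measureReal_compl_of_iUnion {Ω : Type*} [MeasurableSpace Ω] {μ : Measure Ω}
    [IsProbabilityMeasure μ] {A : ℕ → Set Ω} (hm : ∀ N, MeasurableSet (A N))
    (hA : ∀ N, A N ⊆ A (N + 1)) (h1 : μ (⋃ N, A N) = 1) :
    Tendsto (fun n => μ.real (A n)ᶜ) atTop (𝓝 0) := by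
  have h2 := tendsto_measure_iUnion_atTop (μ := μ) (monotone_nat_of_le_succ hA)
  rw [h1] at h2
  have h3 : Tendsto (fun n => μ.real (A n)) atTop (𝓝 1) :=
    (ENNReal.tendsto_toReal ENNReal.one_ne_top).comp h2
  simp only [probReal_compl_eq_one_sub (hm _)]
  simpa using h3.const_sub 1

/-- The scaled deviation `√n (g - f)` of bounded functions, as an element of `ℓ^∞(X)`. -/
theorem toEllInfty_sqrt_mul_sub_apply {X : Type*} {f g : X → ℝ} (hf : Memℓp f ⊤)
    (hg : Memℓp g ⊤) (n : ℕ) (x : X) :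
    toEllInfty (fun x => √(n : ℝ) * (g x - f x)) x = √(n : ℝ) * (g x - f x) :=
  toEllInfty_apply ((hg.sub hf).const_smul (√(n : ℝ))) x

theorem mainTheorem5
    {Ω Ω' Ξ X : Type*} [MeasurableSpace Ω] [MeasurableSpace Ω'] [MeasurableSpace Ξ] [Nonempty X]
    (μ : Measure Ω) [IsProbabilityMeasure μ]
    (ν : Measure Ω') [IsProbabilityMeasure ν]
    -- the i.i.d. sample with law `P`
    (P : Measure Ξ) (ξ : ℕ → Ω → Ξ)
    (hξ_meas : ∀ i, Measurable (ξ i))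
    (hξ_indep : iIndepFun ξ μ)
    (hξ_law : ∀ i, μ.map (ξ i) = P)
    -- the loss
    (h : X → Ξ → ℝ)
    (hh_meas : ∀ x, Measurable (h x))
    (hh_int : ∀ x, Integrable (h x) P)
    -- `f` is bounded; for all large `n` the empirical objective is almost surely bounded
    (hf : Memℓp (expObj h P) ⊤)
    (hfhat : ∀ᶠ n in atTop, ∀ᵐ ω ∂μ, Memℓp (empObj h ξ n ω) ⊤)
    -- `√n (f̂_n - f) ⇝ G` in `ℓ^∞(X)`
    (G : Ω' → EllInfty X)
    (hG : HJWeakConv μ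
      (fun n ω => toEllInfty fun x => √(n : ℝ) * (empObj h ξ n ω x - expObj h P x)) ν G) :
    -- the limit in `ε ↓ 0` exists, and `√n (ψ̂_n - ψ*)` converges weakly to it
    (∃ L : Ω' → ℝ,
      (∀ ω', Tendsto (fun ε : ℝ => ⨅ x : nearMin (expObj h P) ε, G ω' (x : X))
        (𝓝[>] 0) (𝓝 (L ω'))) ∧
      HJWeakConv μ
        (fun n ω => √(n : ℝ) * (infVal (empObj h ξ n ω) - infVal (expObj h P))) ν L) ∧
    IsBigOPStar μ (fun n ω => infVal (empObj h ξ n ω) - infVal (expObj h P))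
      (fun n => (n : ℝ) ^ (-(1 / 2) : ℝ)) ∧
    ∀ (δ : ℕ → ℝ) (xhat : ℕ → Ω → X), (∀ n, 0 ≤ δ n) →
      (δ =O[atTop] fun n => (n : ℝ) ^ (-(1 / 2) : ℝ)) →
      EmpMinMembership μ h ξ δ xhat →
      IsBigOPStar μ (fun n ω => expObj h P (xhat n ω) - infVal (expObj h P))
        (fun n => (n : ℝ) ^ (-(1 / 2) : ℝ)) ∧
      -- now `X` is a subset of `ℝ^d`, with inclusion `e`
      ∀ (d : ℕ) (e : X → EuclideanSpace ℝ (Fin d)), Function.Injective e →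
        ∀ κ : ℝ, SharpGrowth e (expObj h P) κ →
          IsBigOPStar μ
            (fun n ω => Metric.infDist (e (xhat n ω)) (e '' nearMin (expObj h P) 0))
            (fun n => (n : ℝ) ^ (-(1 / (2 * κ)) : ℝ)) := by
  have hfb := hf.bddBelow_range
  have hpos : ∀ᶠ n : ℕ in atTop, 0 < √(n : ℝ) := by
    filter_upwards [eventually_gt_atTop 0] with n hn
    exact Real.sqrt_pos.2 (by exact_mod_cast hn)
  set Z : ℕ → Ω → EllInfty X := fun n ω =>
    toEllInfty fun x => √(n : ℝ) * (empObj h ξ n ω x - expObj h P x) with hZdef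
  have hZ : ∀ᶠ n : ℕ in atTop, ∀ᵐ ω ∂μ, penalizedInf (expObj h P) (√(n : ℝ)) (Z n ω) =
      √(n : ℝ) * (infVal (empObj h ξ n ω) - infVal (expObj h P)) := by
    filter_upwards [hpos, hfhat] with n hn hb
    filter_upwards [hb] with ω hω
    exact penalizedInf_eq_mul_sub hfb hω.bddBelow_range hn
      fun x => toEllInfty_sqrt_mul_sub_apply hf hω n x
  have hψ : ∀ᶠ n : ℕ in atTop, ∀ᵐ ω ∂μ,
      √(n : ℝ) * |infVal (empObj h ξ n ω) - infVal (expObj h P)| ≤ ‖Z n ω‖ := by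
    filter_upwards [hZ] with n hn
    filter_upwards [hn] with ω hω
    rw [← abs_of_nonneg (Real.sqrt_nonneg (n : ℝ)), ← abs_mul, ← hω, abs_le]
    exact ⟨neg_norm_le_penalizedInf hfb (Real.sqrt_nonneg _) _,
      penalizedInf_le_norm hfb (Real.sqrt_nonneg _) _⟩
  have hr : ∀ n : ℕ, 0 ≤ (n : ℝ) ^ (-(1 / 2) : ℝ) := fun n => by positivity
  refine ⟨⟨fun ω' => infDeriv (expObj h P) (G ω'), fun ω' => tendsto_iInf_nearMin hfb (G ω'), ?_⟩,
    ?_, ?_⟩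
  · refine hG.of_monotone_approx (fun m => continuous_penalizedInf hfb (Real.sqrt_nonneg (m : ℝ)))
      (continuous_infDeriv hfb) (tendsto_penalizedInf hfb) (fun m => ?_) ?_
    · filter_upwards [hZ, eventually_ge_atTop m] with n hn hmn
      filter_upwards [hn] with ω hω
      rw [← hω]
      exact penalizedInf_mono hfb (Real.sqrt_nonneg _)
        (Real.sqrt_le_sqrt (by exact_mod_cast hmn)) _
    · filter_upwards [hZ] with n hn
      filter_upwards [hn] with ω hω
      rw [← hω]
      exact penalizedInf_le_infDeriv hfb n _
  · refine hG.isBigOPStar_of_le hr zero_le_one (C := 0) (B := fun _ => ∅) (by simp) ?_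
    filter_upwards [hψ, hpos] with n hn hp
    filter_upwards [hn] with ω hω _
    rw [rpow_neg_half_eq, one_mul, add_zero, ← div_eq_mul_inv, le_div_iff₀ hp, mul_comm]
    exact hω
  · rintro δ xhat - hδ ⟨A, hAm, hA, hA1, hmem⟩
    obtain ⟨C, hC⟩ := hδ.bound
    have key : IsBigOPStar μ (fun n ω => expObj h P (xhat n ω) - infVal (expObj h P))
        (fun n => (n : ℝ) ^ (-(1 / 2) : ℝ)) := by
      -- One `‖Z n ω‖` pays for replacing `f` by `f̂_n` at `x̂_n`, the other for `ψ̂_n - ψ*`; `C`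
      -- comes from `δ`. The exceptional set at stage `n` is `(A n)ᶜ`, so membership is used with `N
      -- = n`.
      refine hG.isBigOPStar_of_le hr zero_le_two (C := C)
        (tendsto_measureReal_compl_of_iUnion hAm hA hA1) ?_
      filter_upwards [hψ, hfhat, hpos, hC] with n hn hb hp hc
      filter_upwards [hn, hb] with ω hω hbω hωA
      have hmin : empObj h ξ n ω (xhat n ω) ≤ infVal (empObj h ξ n ω) + δ n :=
        hmem n ω (not_not.1 hωA) n le_rfl
      rw [abs_of_nonneg (sub_nonneg.2 (infVal_le hfb _))]
      rw [Real.norm_of_nonneg (hr n), rpow_neg_half_eq, ← div_eq_mul_inv, le_div_iff₀ hp] at hc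
      rw [rpow_neg_half_eq, ← div_eq_mul_inv, le_div_iff₀ hp]
      have h1 := (abs_le.1 ((Z n ω).abs_apply_le_norm (xhat n ω))).1
      rw [show Z n ω (xhat n ω) = _ from
        toEllInfty_sqrt_mul_sub_apply hf hbω n (xhat n ω)] at h1
      have h2 := (mul_le_mul_of_nonneg_left (le_abs_self _) hp.le).trans hω
      have h3 := mul_le_mul_of_nonneg_left hmin hp.le
      have h4 := mul_le_mul_of_nonneg_right (Real.le_norm_self (δ n)) hp.le
      linarith
    refine ⟨key, fun d e _ κ hκ => ?_⟩
    obtain ⟨hκ1, -, α, hα, hgrow⟩ := hκ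
    have h1 := key.of_growth (V := fun n ω =>
      Metric.infDist (e (xhat n ω)) (e '' nearMin (expObj h P) 0)) hκ1 hα
      (fun n ω => Metric.infDist_nonneg) fun n ω => hgrow (xhat n ω)
    simpa only [div_div] using h1
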